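/- For integers $a,b,c\ge 0$ with $a,b$ not both $0$, let $\theta(a,b,c)$ be the digraph on $a+b+c+2$ vertices that consists of three internally disjoint directed paths with $a+2$, $b+2$ and $c+2$ vertices, where the first two go from a vertex $s$ to a vertex $t\ne s$ and the third goes from $t$ to $s$. A digraph isomorphic to some such $\theta(a,b,c)$ is called a $\theta$-digraph. The complementarity spectrum $\Pi(D)$ of a finite digraph $D$ on $n$ vertices with adjacency matrix $A$ is the set of all $\lambda\in\mathbb{R}$ for which there is a nonzero vector $x\in\mathbb{R}^n$ with $x\ge 0$, $Ax\ge\lambda x$ (both entrywise) and $\langle x, Ax-\lambda x\rangle=0$. Theorem. The class of $\theta$-digraphs is determined by its complementarity spectrum: if $D$ and $H$ are $\theta$-digraphs with the same number of vertices and $\Pi(D)=\Pi(H)$, then $D$ and $H$ are isomorphic. -/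

import Mathlib

/-- The adjacency matrix `A(D) = (a i j)` of a digraph: `a i j = 1` if `(i, j)` is an arc and
`a i j = 0` otherwise. -/
noncomputable def Digraph.adjacencyMatrix {V : Type*} (D : Digraph V) : Matrix V V ℝ :=
  open Classical in Matrix.of fun i j => if D.Adj i j then 1 else 0

/-- The complementarity spectrum `Π(A)` of a real square matrix: the set of all real `t` for which
there is a nonzero, entrywise nonnegative vector `x` with `A x ≥ t x` (entrywise) and
`⟨x, A x - t x⟩ = 0`. -/
def complementaritySpectrum {V : Type*} [Fintype V] (A : Matrix V V ℝ) : Set ℝ :=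
  {t | ∃ x : V → ℝ, x ≠ 0 ∧ 0 ≤ x ∧ t • x ≤ A.mulVec x ∧ dotProduct x (A.mulVec x - t • x) = 0}

/-- The complementarity spectrum `Π(D)` of a finite digraph. -/
def Digraph.complementaritySpectrum {V : Type*} [Fintype V] (D : Digraph V) : Set ℝ :=
  _root_.complementaritySpectrum D.adjacencyMatrix

/-- Isomorphism of digraphs: a bijection between the vertex sets that preserves and reflects
arcs. -/
def Digraph.Isomorphic {V W : Type*} (D : Digraph V) (H : Digraph W) : Prop :=
  Nonempty (D.Adj ≃r H.Adj)

/-- The `a + b + c + 2` vertices of `θ(a, b, c)`: two branching vertices `s` and `t`, and the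
inner vertices of three paths with `a + 2`, `b + 2` and `c + 2` vertices. -/
inductive ThetaVertex (a b c : ℕ) : Type
  | s : ThetaVertex a b c
  | t : ThetaVertex a b c
  | innerA (i : Fin a) : ThetaVertex a b c
  | innerB (i : Fin b) : ThetaVertex a b c
  | innerC (i : Fin c) : ThetaVertex a b c

namespace ThetaVertex

/-- The vertex sequence of a path: a start vertex, `k` inner vertices, an end vertex. -/
def path {V : Type*} {k : ℕ} (start : V) (inner : Fin k → V) (finish : V) : Fin (k + 2) → V :=
  Fin.cons start (Fin.snoc inner finish : Fin (k + 1) → V)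

/-- The first path, with `a + 2` vertices, from `s` to `t`. -/
def pathA (a b c : ℕ) : Fin (a + 2) → ThetaVertex a b c := path s innerA t

/-- The second path, with `b + 2` vertices, from `s` to `t`. -/
def pathB (a b c : ℕ) : Fin (b + 2) → ThetaVertex a b c := path s innerB t

/-- The third path, with `c + 2` vertices, from `t` back to `s`. -/
def pathC (a b c : ℕ) : Fin (c + 2) → ThetaVertex a b c := path t innerC s

end ThetaVertex

/-- The digraph `θ(a, b, c)`: its arcs are those joining consecutive vertices of one of the three
directed paths. -/
def thetaDigraph (a b c : ℕ) : Digraph (ThetaVertex a b c) where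
  Adj x y :=
    (∃ i : Fin (a + 1), ThetaVertex.pathA a b c i.castSucc = x ∧ ThetaVertex.pathA a b c i.succ = y) ∨
    (∃ i : Fin (b + 1), ThetaVertex.pathB a b c i.castSucc = x ∧ ThetaVertex.pathB a b c i.succ = y) ∨
    (∃ i : Fin (c + 1), ThetaVertex.pathC a b c i.castSucc = x ∧ ThetaVertex.pathC a b c i.succ = y)

/-- A `θ`-digraph is a digraph isomorphic to some `θ(a, b, c)` with `a` and `b` not both zero
(for `a = b = 0` the first two paths would be a double arc). -/
def Digraph.IsTheta {V : Type*} (D : Digraph V) : Prop :=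
  ∃ a b c : ℕ, (a ≠ 0 ∨ b ≠ 0) ∧ D.Isomorphic (thetaDigraph a b c)

/-!
For `λ > 1`, the number `λ` lies in `Π(θ(a, b, c))` if and only if `λ ^ n = λ ^ a + λ ^ b`, where
`n = a + b + c + 2` (`ThetaVertex.mem_complementaritySpectrum_iff_pow_eq`). Indeed, on the support
of a complementary vector the entries are multiplied by `λ` along each arc that leaves a vertex of
out-degree one; the support therefore contains `s` and `t`, and going once around the digraph yields
the equation. Conversely a root gives a positive eigenvector. Such a root `λ > 1` exists, so two
`θ`-digraphs of the same order and with the same spectrum share it.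

With `x = 1 / λ` the equation reads `x ^ p + x ^ q = 1`, where `p = b + c + 2` and `q = a + c + 2`.
It remains to see that a number `0 < x < 1` does not satisfy a second equation `x ^ r + x ^ s = 1`
of this kind. If the exponents are distinct in one equation and equal in the other, then `x` is an
algebraic integer by the first and `1 / 2` is a power of `x` by the second, which is impossible. If
they are equal in both, there is nothing to do. Otherwise both trinomials `F = X ^ q + X ^ p - 1`
and `G = X ^ s + X ^ r - 1` are divisible by the minimal polynomial `f` of `x` over `ℤ`. By
Ljunggren's argument, whenever `F = f * g`, one of `f` and `g` is up to sign its own mirror image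
(reciprocal polynomial): the product of `f` and the mirror image of `g` is a unit trinomial which
has the same product with its mirror image as `F` has, so it is `± F` or the mirror image of `± F`
(`Polynomial.IsUnitTrinomial.mirror_factor`). It is not `f` that is symmetric, since `1 / x` is not
a root of `F`. So the cofactors of `f` in `F` and in `G` are symmetric, and this forces `F *
G.mirror = F.mirror * G` (`Polynomial.trinomial_mul_mirror_eq`). Comparing coefficients leaves, for
two different pairs, only `(p, q) = (k, 5 * k)` and `(r, s) = (2 * k, 3 * k)`, or the same with the
two pairs exchanged (`Polynomial.eq_five_mul_of_pow_add_pow_eq_one`); for `k = 1` both equations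
then indeed hold at the reciprocal of the plastic number. This last coincidence is excluded by `q <
r + s`, which holds for two `θ`-digraphs of the same order `n` because `q ≤ n` and `n + 2 ≤ r + s`.
-/

/-! ### Unit trinomials with a common root -/

namespace Polynomial

/-- Among all integer polynomials, the product with the mirror image determines a unit trinomial up to
sign and mirroring. -/
theorem IsUnitTrinomial.eq_or_eq_neg_of_mul_mirror_eq {p q : ℤ[X]} (hp : p.IsUnitTrinomial)
    (hpq : p * p.mirror = q * q.mirror) :
    q = p ∨ q = -p ∨ q = p.mirror ∨ q = -p.mirror := by
  have hq : IsUnitTrinomial q := (isUnitTrinomial_iff'' hpq).mp hp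
  obtain ⟨k, m, n, hkm, hmn, u, v, w, hp⟩ := hp
  obtain ⟨k', m', n', hkm', hmn', x, y, z, hq⟩ := hq
  have hk : k = k' := by
    rw [← mul_right_inj' (show 2 ≠ 0 from two_ne_zero), ←
      trinomial_natTrailingDegree hkm hmn u.ne_zero, ← hp, ← natTrailingDegree_mul_mirror, hpq,
      natTrailingDegree_mul_mirror, hq, trinomial_natTrailingDegree hkm' hmn' x.ne_zero]
  have hn : n = n' := by
    rw [← mul_right_inj' (show 2 ≠ 0 from two_ne_zero), ← trinomial_natDegree hkm hmn w.ne_zero, ←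
      hp, ← natDegree_mul_mirror, hpq, natDegree_mul_mirror, hq,
      trinomial_natDegree hkm' hmn' z.ne_zero]
  subst hk
  subst hn
  rcases eq_or_eq_neg_of_sq_eq_sq (y : ℤ) (v : ℤ)
      ((Int.isUnit_sq y.isUnit).trans (Int.isUnit_sq v.isUnit).symm) with
    (h1 | h1)
  · rw [h1] at hq
    rcases irreducible_aux3 hkm hmn hkm' hmn' u v w x z hp hq hpq with (h2 | h2)
    · exact Or.inl h2
    · exact Or.inr (Or.inr (Or.inl h2))
  · rw [h1] at hq
    rw [trinomial_def] at hp
    rw [← neg_inj, neg_add, neg_add, ← neg_mul, ← neg_mul, ← neg_mul, ← C_neg, ← C_neg, ← C_neg]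
      at hp
    rw [← neg_mul_neg, ← mirror_neg] at hpq
    rcases irreducible_aux3 hkm hmn hkm' hmn' (-u) (-v) (-w) x z hp hq hpq with (rfl | rfl)
    · exact Or.inr (Or.inl rfl)
    · exact Or.inr (Or.inr (Or.inr p.mirror_neg))

/-- In any factorization of a unit trinomial into two factors, one of the factors is, up to sign, its
own mirror image: `f * g.mirror` has the same product with its mirror image as `f * g` has. -/
theorem IsUnitTrinomial.mirror_factor {f g : ℤ[X]} (h : (f * g).IsUnitTrinomial) :
    (f.mirror = f ∨ f.mirror = -f) ∨ (g.mirror = g ∨ g.mirror = -g) := by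
  have hf : f ≠ 0 := left_ne_zero_of_mul h.ne_zero
  have hg : g ≠ 0 := right_ne_zero_of_mul h.ne_zero
  have hfm : f.mirror ≠ 0 := by rwa [Ne, mirror_eq_zero]
  have hgm : g.mirror ≠ 0 := by rwa [Ne, mirror_eq_zero]
  have key : f * g * (f * g).mirror = f * g.mirror * (f * g.mirror).mirror := by
    rw [mirror_mul_of_domain, mirror_mul_of_domain, mirror_mirror]; ring
  rcases h.eq_or_eq_neg_of_mul_mirror_eq key with h | h | h | h
  · exact .inr <| .inl <| mul_left_cancel₀ hf h
  · exact .inr <| .inr <| mul_left_cancel₀ hf (by rw [h, mul_neg])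
  · rw [mirror_mul_of_domain] at h
    exact .inl <| .inl <| (mul_right_cancel₀ hgm h).symm
  · rw [mirror_mul_of_domain, ← neg_mul] at h
    exact .inl <| .inr <| (neg_eq_iff_eq_neg.mp (mul_right_cancel₀ hgm h).symm)

theorem isUnitTrinomial_neg_one_one_one {p q : ℕ} (hp : 0 < p) (hpq : p < q) :
    (trinomial 0 p q (-1 : ℤ) 1 1).IsUnitTrinomial :=
  ⟨0, p, q, hp, hpq, -1, 1, 1, by simp⟩

theorem aeval_trinomial_neg_one_one_one (p q : ℕ) (x : ℝ) :
    aeval x (trinomial 0 p q (-1 : ℤ) 1 1) = x ^ p + x ^ q - 1 := by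
  simp [trinomial_def]; ring

theorem mirror_trinomial_neg_one_one_one {p q : ℕ} (hp : 0 < p) (hpq : p < q) :
    (trinomial 0 p q (-1 : ℤ) 1 1).mirror = trinomial 0 (q - p) q (1 : ℤ) 1 (-1) := by
  rw [trinomial_mirror hp hpq (by norm_num) one_ne_zero, add_zero]

/-- If `f` has a root `x` in `(0, 1)`, then the cofactor of `f` in `X ^ q + X ^ p - 1` is symmetric up
to sign: otherwise `f` would be, and `x` would also be a root of the mirror image
`1 + X ^ (q - p) - X ^ q`, which is positive on `(0, 1)`. -/
theorem mirror_cofactor {p q : ℕ} (hp : 0 < p) (hpq : p < q) {x : ℝ}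
    (hx0 : 0 < x) (hx1 : x < 1) {f g : ℤ[X]} (hf : aeval x f = 0)
    (hfg : trinomial 0 p q (-1 : ℤ) 1 1 = f * g) : g.mirror = g ∨ g.mirror = -g := by
  have hu := isUnitTrinomial_neg_one_one_one hp hpq
  rw [hfg] at hu
  refine hu.mirror_factor.resolve_left fun h => ?_
  have hfm : aeval x f.mirror = 0 := by rcases h with h | h <;> simp [h, hf]
  have h0 : aeval x (trinomial 0 (q - p) q (1 : ℤ) 1 (-1)) = 0 := by
    rw [← mirror_trinomial_neg_one_one_one hp hpq, hfg, mirror_mul_of_domain, map_mul, hfm,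
      zero_mul]
  have h1 : x ^ q < 1 := pow_lt_one₀ hx0.le hx1 (by omega)
  have h2 : 0 < x ^ (q - p) := by positivity
  simp [trinomial_def] at h0
  linarith

theorem isIntegral_of_pow_add_pow_eq_one {p q : ℕ} (hp : 0 < p) (hpq : p < q) {x : ℝ}
    (h : x ^ p + x ^ q = 1) : IsIntegral ℤ x :=
  ⟨trinomial 0 p q (-1 : ℤ) 1 1, trinomial_monic hp hpq, by
    rw [← aeval_def, aeval_trinomial_neg_one_one_one, h, sub_self]⟩

/-- If `F = X ^ q + X ^ p - 1` and `G = X ^ s + X ^ r - 1` have a common root in `(0, 1)`, then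
`F * G.mirror = F.mirror * G`. Both sides are, up to sign, the product of the minimal polynomial of
the root, its mirror image, and the two cofactors. -/
theorem trinomial_mul_mirror_eq {p q r s : ℕ} (hp : 0 < p) (hpq : p < q) (hr : 0 < r) (hrs : r < s)
    {x : ℝ} (hx0 : 0 < x) (hx1 : x < 1) (h : x ^ p + x ^ q = 1) (h' : x ^ r + x ^ s = 1) :
    trinomial 0 p q (-1 : ℤ) 1 1 * trinomial 0 (s - r) s (1 : ℤ) 1 (-1) =
      trinomial 0 (q - p) q (1 : ℤ) 1 (-1) * trinomial 0 r s (-1 : ℤ) 1 1 := by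
  have hint := isIntegral_of_pow_add_pow_eq_one hp hpq h
  obtain ⟨g, hg⟩ := minpoly.isIntegrallyClosed_dvd hint (p := trinomial 0 p q (-1 : ℤ) 1 1)
    (by rw [aeval_trinomial_neg_one_one_one, h, sub_self])
  obtain ⟨k, hk⟩ := minpoly.isIntegrallyClosed_dvd hint (p := trinomial 0 r s (-1 : ℤ) 1 1)
    (by rw [aeval_trinomial_neg_one_one_one, h', sub_self])
  have hgm := mirror_cofactor hp hpq hx0 hx1 (minpoly.aeval ℤ x) hg
  have hkm := mirror_cofactor hr hrs hx0 hx1 (minpoly.aeval ℤ x) hk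
  rw [← mirror_trinomial_neg_one_one_one hp hpq, ← mirror_trinomial_neg_one_one_one hr hrs]
  have key : trinomial 0 p q (-1 : ℤ) 1 1 * (trinomial 0 r s (-1 : ℤ) 1 1).mirror =
        (trinomial 0 p q (-1 : ℤ) 1 1).mirror * trinomial 0 r s (-1 : ℤ) 1 1 ∨
      trinomial 0 p q (-1 : ℤ) 1 1 * (trinomial 0 r s (-1 : ℤ) 1 1).mirror =
        -((trinomial 0 p q (-1 : ℤ) 1 1).mirror * trinomial 0 r s (-1 : ℤ) 1 1) := by
    rw [hg, hk, mirror_mul_of_domain, mirror_mul_of_domain]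
    rcases hgm with hgm | hgm <;> rcases hkm with hkm | hkm <;> rw [hgm, hkm]
    · left; ring
    · right; ring
    · right; ring
    · left; ring
  -- The constant terms `-1` rule out the minus sign.
  refine key.resolve_right fun h => ?_
  rw [mirror_trinomial_neg_one_one_one hp hpq, mirror_trinomial_neg_one_one_one hr hrs] at h
  have h0 := congrArg (eval 0) h
  have : q ≠ 0 := by omega
  have : s ≠ 0 := by omega
  have : q - p ≠ 0 := by omega
  have : s - r ≠ 0 := by omega
  simp [trinomial_def, hp.ne', hr.ne', *] at h0

/-- The identity `F * G.mirror = F.mirror * G` after expansion and cancellation. -/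
theorem quintinomial_eq {p q r s : ℕ} (hp : 0 < p) (hpq : p < q) (hr : 0 < r) (hrs : r < s)
    {x : ℝ} (hx0 : 0 < x) (hx1 : x < 1) (h : x ^ p + x ^ q = 1) (h' : x ^ r + x ^ s = 1) :
    (X ^ p + X ^ (q - p) + X ^ (p + (s - r)) + X ^ (q + (s - r)) + X ^ (q + r) : ℤ[X]) =
      X ^ r + X ^ (s - r) + X ^ (r + (q - p)) + X ^ (s + (q - p)) + X ^ (s + p) := by
  have key := trinomial_mul_mirror_eq hp hpq hr hrs hx0 hx1 h h'
  simp only [trinomial_def, C_neg, C_1, pow_zero] at key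
  linear_combination (exp := 1) key

/-- The only coincidences between the roots of two trinomials `X ^ q + X ^ p - 1` in `(0, 1)` are
those that come from `X ^ 5 + X - 1 = (X ^ 3 + X ^ 2 - 1) * (X ^ 2 - X + 1)`. -/
theorem eq_five_mul_of_pow_add_pow_eq_one {p q r s : ℕ} (hp : 0 < p) (hpr : p < r) (hrs : r < s)
    (hsq : s < q) {x : ℝ} (hx0 : 0 < x) (hx1 : x < 1) (h : x ^ p + x ^ q = 1)
    (h' : x ^ r + x ^ s = 1) : q = 5 * p ∧ r = 2 * p ∧ s = 3 * p := by
  have key := quintinomial_eq hp (by omega) (by omega) hrs hx0 hx1 h h'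
  have hcoeff (d : ℕ) := congrArg (coeff · d) key
  simp only [coeff_add, coeff_X_pow] at hcoeff
  -- The term `X ^ p` on the left has to cancel with `X ^ (s - r)`, the only candidate.
  have hs : s = r + p := by
    by_contra hs
    have := hcoeff p
    grind
  subst hs
  -- Now `X ^ (p + (s - r)) = X ^ (2 * p)` has to cancel with `X ^ r`.
  have hr : r = 2 * p := by
    by_contra hr
    have := hcoeff (2 * p)
    grind
  subst hr
  -- Finally `X ^ (s + p) = X ^ (4 * p)` has to cancel with `X ^ (q - p)`.
  have hq : q = 5 * p := by
    by_contra hq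
    have := hcoeff (4 * p)
    grind
  omega

theorem not_isIntegral_of_two_mul_pow_eq_one {x : ℝ} {r : ℕ} (h : 2 * x ^ r = 1) :
    ¬ IsIntegral ℤ x := by
  intro hx
  have h2 : IsIntegral ℤ (algebraMap ℚ ℝ (1 / 2)) := by
    have := hx.pow r
    rwa [show x ^ r = algebraMap ℚ ℝ (1 / 2) by simp; linarith] at this
  rw [isIntegral_algebraMap_iff (algebraMap ℚ ℝ).injective,
    IsIntegrallyClosed.isIntegral_iff] at h2
  obtain ⟨y, hy⟩ := h2
  have : (2 * y : ℤ) = 1 := by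
    have : (2 * y : ℚ) = 1 := by simp at hy; linarith
    exact_mod_cast this
  omega

end Polynomial

/-! ### The equation of a theta digraph -/

/-- The hypothesis `q < r + s` excludes the exceptional case `(p, q) = (k, 5 * k)`,
`(r, s) = (2 * k, 3 * k)`. -/
theorem exponents_eq_of_le {p q r s : ℕ} (hp : 0 < p) (hpq : p ≤ q) (hrs : r ≤ s)
    (hsq : s ≤ q) (hsum : q < r + s) {x : ℝ} (hx0 : 0 < x) (hx1 : x < 1)
    (h : x ^ p + x ^ q = 1) (h' : x ^ r + x ^ s = 1) : p = r ∧ q = s := by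
  rcases hsq.eq_or_lt with rfl | hsq
  · exact ⟨(pow_right_strictAnti₀ hx0 hx1).injective (by linarith : x ^ p = x ^ r), rfl⟩
  · have hlt : x ^ q < x ^ s := pow_right_strictAnti₀ hx0 hx1 hsq
    have hpr : p < r :=
      (pow_right_strictAnti₀ hx0 hx1).lt_iff_gt.mp (by linarith : x ^ r < x ^ p)
    rcases hrs.eq_or_lt with rfl | hrs
    · exact absurd (Polynomial.isIntegral_of_pow_add_pow_eq_one hp (by omega) h)
        (Polynomial.not_isIntegral_of_two_mul_pow_eq_one (by linarith : 2 * x ^ r = 1))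
    · have := Polynomial.eq_five_mul_of_pow_add_pow_eq_one hp hpr hrs hsq hx0 hx1 h h'
      omega

theorem exponents_eq {p q r s : ℕ} (hp : 0 < p) (hpq : p ≤ q) (hr : 0 < r) (hrs : r ≤ s)
    (hs : s < p + q) (hq : q < r + s) {x : ℝ} (hx0 : 0 < x) (hx1 : x < 1)
    (h : x ^ p + x ^ q = 1) (h' : x ^ r + x ^ s = 1) : p = r ∧ q = s := by
  rcases le_total s q with hsq | hsq
  · exact exponents_eq_of_le hp hpq hrs hsq hq hx0 hx1 h h'
  · exact (exponents_eq_of_le hr hrs hpq hsq hs hx0 hx1 h' h).imp Eq.symm Eq.symm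

theorem theta_parameters_eq_of_le {a b c a' b' c' : ℕ} (hab : b ≤ a) (hab' : b' ≤ a')
    (hn : a + b + c = a' + b' + c') {t : ℝ} (ht : 1 < t)
    (h : t ^ (a + b + c + 2) = t ^ a + t ^ b)
    (h' : t ^ (a' + b' + c' + 2) = t ^ a' + t ^ b') : a = a' ∧ b = b' := by
  have ht0 : t ≠ 0 := by positivity
  -- In terms of `t⁻¹` the equation has the form treated in `exponents_eq`.
  have main {k l m : ℕ} (h : t ^ (k + l + m + 2) = t ^ k + t ^ l) :
      t⁻¹ ^ (l + m + 2) + t⁻¹ ^ (k + m + 2) = 1 := by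
    have e1 : t⁻¹ ^ (l + m + 2) = t ^ k / t ^ (k + l + m + 2) := by
      rw [show k + l + m + 2 = k + (l + m + 2) by ring, pow_add t k, inv_pow]
      field_simp
    have e2 : t⁻¹ ^ (k + m + 2) = t ^ l / t ^ (k + l + m + 2) := by
      rw [show k + l + m + 2 = l + (k + m + 2) by ring, pow_add t l, inv_pow]
      field_simp
    rw [e1, e2, ← add_div, ← h, div_self (pow_ne_zero _ ht0)]
  have := exponents_eq (by omega) (by omega) (by omega) (by omega) (by omega) (by omega)
    (inv_pos.mpr (by linarith)) (inv_lt_one_of_one_lt₀ ht) (main h) (main h')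
  omega

/-- The number of vertices and a common root `t > 1` of the equations of two theta digraphs determine
the parameters up to exchanging the first two paths. -/
theorem theta_parameters_eq {a b c a' b' c' : ℕ} (hn : a + b + c = a' + b' + c') {t : ℝ}
    (ht : 1 < t) (h : t ^ (a + b + c + 2) = t ^ a + t ^ b)
    (h' : t ^ (a' + b' + c' + 2) = t ^ a' + t ^ b') :
    (a = a' ∧ b = b' ∧ c = c') ∨ (a = b' ∧ b = a' ∧ c = c') := by
  wlog hab : b ≤ a generalizing a b
  · have := this (a := b) (b := a) (by omega) (by rw [add_comm b a, h, add_comm]) (by omega)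
    omega
  wlog hab' : b' ≤ a' generalizing a' b'
  · have := this (a' := b') (b' := a') (by rw [add_comm b' a', h', add_comm]) (by omega) (by omega)
    omega
  have := theta_parameters_eq_of_le hab hab' hn ht h h'
  omega

theorem exists_one_lt_pow_eq (a b c : ℕ) :
    ∃ t : ℝ, 1 < t ∧ t ^ (a + b + c + 2) = t ^ a + t ^ b := by
  have hcont : ContinuousOn (fun t : ℝ => t ^ (a + b + c + 2) - (t ^ a + t ^ b)) (Set.Icc 1 2) := by
    fun_prop
  have h0 : (0 : ℝ) ∈ Set.Icc ((1 : ℝ) ^ (a + b + c + 2) - (1 ^ a + 1 ^ b))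
      (2 ^ (a + b + c + 2) - (2 ^ a + 2 ^ b)) := by
    constructor
    · simp
    · have h1 : (2 : ℝ) ^ a ≤ 2 ^ (a + b + c + 1) := pow_le_pow_right₀ (by norm_num) (by omega)
      have h2 : (2 : ℝ) ^ b ≤ 2 ^ (a + b + c + 1) := pow_le_pow_right₀ (by norm_num) (by omega)
      rw [pow_succ _ (a + b + c + 1)]
      linarith
  obtain ⟨t, ⟨ht, -⟩, h⟩ := intermediate_value_Icc one_le_two hcont h0
  refine ⟨t, ht.lt_of_ne ?_, sub_eq_zero.mp h⟩
  rintro rfl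
  norm_num at h

/-! ### Adjacency in theta digraphs -/

namespace ThetaVertex

variable {a b c : ℕ}

/-- The vertices of `θ(a, b, c)` as a disjoint sum: two branching vertices and three families of
inner vertices. -/
def equivSum (a b c : ℕ) : ThetaVertex a b c ≃ Option (Option (Fin a ⊕ Fin b ⊕ Fin c)) where
  toFun
    | s => none
    | t => some none
    | innerA i => some (some (.inl i))
    | innerB i => some (some (.inr (.inl i)))
    | innerC i => some (some (.inr (.inr i)))
  invFun
    | none => s
    | some none => t
    | some (some (.inl i)) => innerA i
    | some (some (.inr (.inl i))) => innerB i
    | some (some (.inr (.inr i))) => innerC i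
  left_inv v := by cases v <;> rfl
  right_inv v := by rcases v with _ | _ | i | i | i <;> rfl

noncomputable instance : Fintype (ThetaVertex a b c) := Fintype.ofEquiv _ (equivSum a b c).symm

theorem card_eq : Fintype.card (ThetaVertex a b c) = a + b + c + 2 := by
  rw [Fintype.card_congr (equivSum a b c)]
  simp [add_assoc]

/-- The arcs of a path: one leaves its start, and one leaves each inner vertex. The vertices of the path
other than its start form the sequence `Fin.snoc inner finish`. -/
theorem exists_path_adj_iff {V : Type*} {k : ℕ} (start : V) (inner : Fin k → V) (finish x y : V) :
    (∃ i : Fin (k + 1), path start inner finish i.castSucc = x ∧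
        path start inner finish i.succ = y) ↔
      (start = x ∧ Fin.snoc (α := fun _ => V) inner finish 0 = y) ∨
        ∃ i : Fin k, inner i = x ∧ Fin.snoc (α := fun _ => V) inner finish i.succ = y := by
  simp only [path, Fin.exists_fin_succ, Fin.castSucc_zero, Fin.cons_zero, Fin.cons_succ,
    ← Fin.succ_castSucc, Fin.snoc_castSucc]

/-- The vertices of the first path other than its start `s`. The inner vertex `innerA i` has index
`i.castSucc`, so that its out-neighbour has index `i.succ`. -/
def nextA : Fin (a + 1) → ThetaVertex a b c := Fin.snoc (α := fun _ => _) innerA t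

/-- The vertices of the second path other than its start `s`, indexed as in `nextA`. -/
def nextB : Fin (b + 1) → ThetaVertex a b c := Fin.snoc (α := fun _ => _) innerB t

/-- The vertices of the third path other than its start `t`, indexed as in `nextA`. -/
def nextC : Fin (c + 1) → ThetaVertex a b c := Fin.snoc (α := fun _ => _) innerC s

theorem adj_s_iff {v : ThetaVertex a b c} :
    (thetaDigraph a b c).Adj s v ↔ v = nextA 0 ∨ v = nextB 0 := by
  simp [thetaDigraph, pathA, pathB, pathC, exists_path_adj_iff, nextA, nextB, @eq_comm _ v]

theorem adj_t_iff {v : ThetaVertex a b c} : (thetaDigraph a b c).Adj t v ↔ v = nextC 0 := by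
  simp [thetaDigraph, pathA, pathB, pathC, exists_path_adj_iff, nextC, @eq_comm _ v]

theorem adj_innerA_iff {i : Fin a} {v : ThetaVertex a b c} :
    (thetaDigraph a b c).Adj (innerA i) v ↔ v = nextA i.succ := by
  simp [thetaDigraph, pathA, pathB, pathC, exists_path_adj_iff, nextA, @eq_comm _ v]

theorem adj_innerB_iff {i : Fin b} {v : ThetaVertex a b c} :
    (thetaDigraph a b c).Adj (innerB i) v ↔ v = nextB i.succ := by
  simp [thetaDigraph, pathA, pathB, pathC, exists_path_adj_iff, nextB, @eq_comm _ v]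

theorem adj_innerC_iff {i : Fin c} {v : ThetaVertex a b c} :
    (thetaDigraph a b c).Adj (innerC i) v ↔ v = nextC i.succ := by
  simp [thetaDigraph, pathA, pathB, pathC, exists_path_adj_iff, nextC, @eq_comm _ v]

/-- The vertex `s` has two distinct out-neighbours, unless both paths from `s` to `t` are single arcs. -/
theorem nextA_zero_ne_nextB_zero (h : a ≠ 0 ∨ b ≠ 0) :
    (nextA 0 : ThetaVertex a b c) ≠ nextB 0 := by
  cases a <;> cases b <;> simp_all [nextA, nextB, Fin.snoc]

end ThetaVertex

theorem Digraph.adjacencyMatrix_mulVec_of_adj_iff_eq {V : Type*} [Fintype V] (D : Digraph V)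
    (x : V → ℝ) {v w : V} (h : ∀ u, D.Adj v u ↔ u = w) :
    (D.adjacencyMatrix.mulVec x) v = x w := by
  classical
  simp [Matrix.mulVec, dotProduct, adjacencyMatrix, h]

theorem Digraph.adjacencyMatrix_mulVec_of_adj_iff_eq_or {V : Type*} [Fintype V] (D : Digraph V)
    (x : V → ℝ) {v w w' : V} (hw : w ≠ w') (h : ∀ u, D.Adj v u ↔ u = w ∨ u = w') :
    (D.adjacencyMatrix.mulVec x) v = x w + x w' := by
  classical
  simp only [Matrix.mulVec, dotProduct, adjacencyMatrix, Matrix.of_apply, h, ite_mul, one_mul,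
    zero_mul, ← Finset.sum_filter]
  rw [← Finset.sum_pair hw]
  congr 1
  ext u
  simp

theorem Digraph.Isomorphic.symm {V W : Type*} {D : Digraph V} {H : Digraph W}
    (h : D.Isomorphic H) : H.Isomorphic D :=
  h.map RelIso.symm

theorem Digraph.Isomorphic.trans {U V W : Type*} {C : Digraph U} {D : Digraph V} {H : Digraph W}
    (h : C.Isomorphic D) (h' : D.Isomorphic H) : C.Isomorphic H :=
  Nonempty.map2 RelIso.trans h h'

theorem Digraph.Isomorphic.complementaritySpectrum_subset {V W : Type*} [Fintype V] [Fintype W]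
    {D : Digraph V} {H : Digraph W} (h : D.Isomorphic H) :
    D.complementaritySpectrum ⊆ H.complementaritySpectrum := by
  obtain ⟨e⟩ := h
  rintro r ⟨x, hx0, hx, hle, hdot⟩
  have hmul : H.adjacencyMatrix.mulVec (x ∘ e.symm) = D.adjacencyMatrix.mulVec x ∘ e.symm := by
    have : D.adjacencyMatrix = H.adjacencyMatrix.submatrix e e := by
      ext i j
      have hij : H.Adj (e i) (e j) ↔ D.Adj i j := e.map_rel_iff
      simp only [adjacencyMatrix, Matrix.of_apply, Matrix.submatrix_apply]
      split_ifs <;> tauto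
    rw [this]
    ext i
    simp only [Matrix.mulVec, dotProduct, Function.comp, Matrix.submatrix_apply]
    rw [← Equiv.sum_comp e.toEquiv]
    simp
  refine ⟨x ∘ e.symm, ?_, fun i => hx _, ?_, ?_⟩
  · contrapose hx0
    ext i
    simpa using congrFun hx0 (e i)
  · rw [hmul]
    exact fun i => hle _
  · rw [hmul, ← hdot]
    simp only [dotProduct]
    rw [← Equiv.sum_comp e.toEquiv]
    simp

theorem Digraph.Isomorphic.complementaritySpectrum_eq {V W : Type*} [Fintype V] [Fintype W]
    {D : Digraph V} {H : Digraph W} (h : D.Isomorphic H) :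
    D.complementaritySpectrum = H.complementaritySpectrum :=
  h.complementaritySpectrum_subset.antisymm h.symm.complementaritySpectrum_subset

/-! ### Complementarity eigenvalues greater than one -/

/-- Complementarity read entrywise: all summands of `⟨x, A x - r x⟩` are nonnegative, so they vanish
separately. -/
theorem mem_complementaritySpectrum_iff {V : Type*} [Fintype V] {A : Matrix V V ℝ} {r : ℝ} :
    r ∈ complementaritySpectrum A ↔ ∃ x : V → ℝ, x ≠ 0 ∧ 0 ≤ x ∧ r • x ≤ A.mulVec x ∧
      ∀ v, x v ≠ 0 → A.mulVec x v = r * x v := by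
  refine exists_congr fun x => and_congr_right fun _ => and_congr_right fun hx =>
    and_congr_right fun hle => ?_
  simp only [dotProduct, Pi.sub_apply]
  rw [Finset.sum_eq_zero_iff_of_nonneg
    fun v _ => mul_nonneg (hx v) (sub_nonneg.mpr (hle v))]
  simp only [Finset.mem_univ, forall_const, Pi.smul_apply, smul_eq_mul, mul_eq_zero,
    sub_eq_zero, or_iff_not_imp_left, ne_eq]

/-- A sequence that is multiplied by `r` at each step from a nonzero entry stays nonzero and is geometric
from its first nonzero entry on. -/
theorem Fin.apply_last_eq_pow_mul {k : ℕ} {r : ℝ} (hr : r ≠ 0) {g : Fin (k + 1) → ℝ}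
    (h : ∀ i : Fin k, g i.castSucc ≠ 0 → g i.succ = r * g i.castSucc) (i : Fin (k + 1))
    (hi : g i ≠ 0) : g (Fin.last k) = r ^ (k - i : ℕ) * g i := by
  induction i using Fin.reverseInduction with
  | last => simp
  | cast i ih =>
    have hs := h i hi
    rw [ih (by rw [hs]; exact mul_ne_zero hr hi), hs, ← mul_assoc, ← pow_succ]
    congr 2
    simp only [Fin.val_succ, Fin.val_castSucc]
    omega

namespace ThetaVertex

variable {a b c : ℕ}

theorem nextA_castSucc (i : Fin a) : (nextA i.castSucc : ThetaVertex a b c) = innerA i :=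
  Fin.snoc_castSucc (α := fun _ => ThetaVertex a b c) ..

theorem nextB_castSucc (i : Fin b) : (nextB i.castSucc : ThetaVertex a b c) = innerB i :=
  Fin.snoc_castSucc (α := fun _ => ThetaVertex a b c) ..

theorem nextC_castSucc (i : Fin c) : (nextC i.castSucc : ThetaVertex a b c) = innerC i :=
  Fin.snoc_castSucc (α := fun _ => ThetaVertex a b c) ..

theorem nextA_last : (nextA (Fin.last a) : ThetaVertex a b c) = t :=
  Fin.snoc_last (α := fun _ => ThetaVertex a b c) ..

theorem nextB_last : (nextB (Fin.last b) : ThetaVertex a b c) = t :=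
  Fin.snoc_last (α := fun _ => ThetaVertex a b c) ..

theorem nextC_last : (nextC (Fin.last c) : ThetaVertex a b c) = s :=
  Fin.snoc_last (α := fun _ => ThetaVertex a b c) ..

/-- A complementarity eigenvalue greater than one is a root of the equation of the theta digraph. -/
theorem pow_eq_of_mem_complementaritySpectrum (h : a ≠ 0 ∨ b ≠ 0) {r : ℝ} (hr : 1 < r)
    (hmem : r ∈ (thetaDigraph a b c).complementaritySpectrum) :
    r ^ (a + b + c + 2) = r ^ a + r ^ b := by
  have hr0 : r ≠ 0 := by positivity
  obtain ⟨x, hx0, -, -, hx⟩ := mem_complementaritySpectrum_iff.mp hmem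
  have hA : ∀ i, x (nextA i) ≠ 0 → x t = r ^ (a - i : ℕ) * x (nextA i) := by
    rw [← nextA_last]
    refine Fin.apply_last_eq_pow_mul (g := x ∘ nextA) hr0 fun i hi => ?_
    simp only [Function.comp, nextA_castSucc] at hi ⊢
    rw [← hx _ hi, Digraph.adjacencyMatrix_mulVec_of_adj_iff_eq _ _ fun _ => adj_innerA_iff]
  have hB : ∀ i, x (nextB i) ≠ 0 → x t = r ^ (b - i : ℕ) * x (nextB i) := by
    rw [← nextB_last]
    refine Fin.apply_last_eq_pow_mul (g := x ∘ nextB) hr0 fun i hi => ?_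
    simp only [Function.comp, nextB_castSucc] at hi ⊢
    rw [← hx _ hi, Digraph.adjacencyMatrix_mulVec_of_adj_iff_eq _ _ fun _ => adj_innerB_iff]
  have hC : ∀ i, x (nextC i) ≠ 0 → x s = r ^ (c - i : ℕ) * x (nextC i) := by
    rw [← nextC_last]
    refine Fin.apply_last_eq_pow_mul (g := x ∘ nextC) hr0 fun i hi => ?_
    simp only [Function.comp, nextC_castSucc] at hi ⊢
    rw [← hx _ hi, Digraph.adjacencyMatrix_mulVec_of_adj_iff_eq _ _ fun _ => adj_innerC_iff]
  have hs (hs : x s ≠ 0) : x (nextA 0) + x (nextB 0) = r * x s := by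
    rw [← hx _ hs, Digraph.adjacencyMatrix_mulVec_of_adj_iff_eq_or _ _
      (nextA_zero_ne_nextB_zero h) fun _ => adj_s_iff]
  have ht (ht : x t ≠ 0) : x s = r ^ (c + 1) * x t := by
    have h1 : x (nextC 0) = r * x t := by
      rw [← hx _ ht, Digraph.adjacencyMatrix_mulVec_of_adj_iff_eq _ _ fun _ => adj_t_iff]
    rw [hC 0 (by rw [h1]; positivity), h1, pow_succ, mul_assoc]
    simp
  -- Following the arcs forward from any vertex of the support leads to `s`.
  have hs0 : x s ≠ 0 := by
    have hts : x t ≠ 0 → x s ≠ 0 := fun h0 => by rw [ht h0]; positivity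
    obtain ⟨v, hv⟩ := Function.ne_iff.mp hx0
    cases v with
    | s => exact hv
    | t => exact hts hv
    | innerA i =>
      rw [← nextA_castSucc] at hv
      refine hts ?_
      rw [hA _ hv]
      exact mul_ne_zero (pow_ne_zero _ hr0) hv
    | innerB i =>
      rw [← nextB_castSucc] at hv
      refine hts ?_
      rw [hB _ hv]
      exact mul_ne_zero (pow_ne_zero _ hr0) hv
    | innerC i =>
      rw [← nextC_castSucc] at hv
      rw [hC _ hv]
      exact mul_ne_zero (pow_ne_zero _ hr0) hv
  have hsum := hs hs0
  have hA0 := hA 0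
  have hB0 := hB 0
  simp only [Fin.val_zero, tsub_zero] at hA0 hB0
  -- If only one out-neighbour of `s` is in the support, then the entries are multiplied by a
  -- positive power of `r > 1` on a closed walk along one directed cycle, which is absurd.
  have hcyc (k : ℕ) (h0 : x t = r ^ k * (r * x s)) : False := by
    have htne : x t ≠ 0 := by rw [h0]; positivity
    rw [ht htne, ← mul_assoc, ← mul_assoc, ← pow_succ, ← pow_add] at h0
    have : 1 < r ^ (k + 1 + (c + 1)) := one_lt_pow₀ hr (by omega)
    exact this.ne (mul_right_cancel₀ htne (by rw [one_mul]; exact h0))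
  by_cases hA1 : x (nextA 0) = 0
  · by_cases hB1 : x (nextB 0) = 0
    · rw [hA1, hB1, add_zero] at hsum
      exact absurd hsum.symm (mul_ne_zero hr0 hs0)
    · rw [hA1, zero_add] at hsum
      exact (hcyc b (hsum ▸ hB0 hB1)).elim
  · by_cases hB1 : x (nextB 0) = 0
    · rw [hB1, add_zero] at hsum
      exact (hcyc a (hsum ▸ hA0 hA1)).elim
    · have htA := hA0 hA1
      have htB := hB0 hB1
      have htne : x t ≠ 0 := by rw [htA]; exact mul_ne_zero (pow_ne_zero _ hr0) hA1
      rw [ht htne] at hsum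
      refine mul_right_cancel₀ htne ?_
      linear_combination -r ^ (a + b) * hsum - r ^ b * htA - r ^ a * htB

/-- The Perron eigenvector of `θ(a, b, c)` for the eigenvalue `r`, normalized to be `1` at `t`: along
each of the three paths the entries after the first vertex are multiplied by `r` at each step. -/
noncomputable def perronVector (a b c : ℕ) (r : ℝ) : ThetaVertex a b c → ℝ
  | s => r ^ (c + 1)
  | t => 1
  | innerA i => r⁻¹ ^ (a - i : ℕ)
  | innerB i => r⁻¹ ^ (b - i : ℕ)
  | innerC i => r ^ (i + 1 : ℕ)

theorem perronVector_nextA (r : ℝ) (i : Fin (a + 1)) :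
    perronVector a b c r (nextA i) = r⁻¹ ^ (a - i : ℕ) := by
  cases i using Fin.lastCases <;> simp [nextA_last, nextA_castSucc, perronVector]

theorem perronVector_nextB (r : ℝ) (i : Fin (b + 1)) :
    perronVector a b c r (nextB i) = r⁻¹ ^ (b - i : ℕ) := by
  cases i using Fin.lastCases <;> simp [nextB_last, nextB_castSucc, perronVector]

theorem perronVector_nextC (r : ℝ) (i : Fin (c + 1)) :
    perronVector a b c r (nextC i) = r ^ (i + 1 : ℕ) := by
  cases i using Fin.lastCases <;> simp [nextC_last, nextC_castSucc, perronVector]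

theorem adjacencyMatrix_mulVec_perronVector (h : a ≠ 0 ∨ b ≠ 0) {r : ℝ} (hr : 0 < r)
    (hroot : r ^ (a + b + c + 2) = r ^ a + r ^ b) :
    (thetaDigraph a b c).adjacencyMatrix.mulVec (perronVector a b c r) =
      r • perronVector a b c r := by
  have step (k : ℕ) (i : Fin k) : r⁻¹ ^ (k - (i + 1 : ℕ)) = r * r⁻¹ ^ (k - i : ℕ) := by
    rw [show k - i = k - (i + 1 : ℕ) + 1 by omega, pow_succ]
    field_simp
  ext v
  rw [Pi.smul_apply, smul_eq_mul]
  cases v with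
  | s =>
    rw [Digraph.adjacencyMatrix_mulVec_of_adj_iff_eq_or _ _
      (nextA_zero_ne_nextB_zero h) fun _ => adj_s_iff, perronVector_nextA, perronVector_nextB]
    simp only [Fin.val_zero, tsub_zero, perronVector, inv_pow]
    field_simp
    linear_combination -hroot
  | t =>
    rw [Digraph.adjacencyMatrix_mulVec_of_adj_iff_eq _ _ fun _ => adj_t_iff, perronVector_nextC]
    simp [perronVector]
  | innerA i =>
    rw [Digraph.adjacencyMatrix_mulVec_of_adj_iff_eq _ _ fun _ => adj_innerA_iff,
      perronVector_nextA]
    exact step a i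
  | innerB i =>
    rw [Digraph.adjacencyMatrix_mulVec_of_adj_iff_eq _ _ fun _ => adj_innerB_iff,
      perronVector_nextB]
    exact step b i
  | innerC i =>
    rw [Digraph.adjacencyMatrix_mulVec_of_adj_iff_eq _ _ fun _ => adj_innerC_iff,
      perronVector_nextC]
    exact pow_succ' ..

theorem mem_complementaritySpectrum_iff_pow_eq (h : a ≠ 0 ∨ b ≠ 0) {r : ℝ} (hr : 1 < r) :
    r ∈ (thetaDigraph a b c).complementaritySpectrum ↔ r ^ (a + b + c + 2) = r ^ a + r ^ b := by
  refine ⟨pow_eq_of_mem_complementaritySpectrum h hr, fun hroot => ?_⟩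
  have hA := adjacencyMatrix_mulVec_perronVector h (by linarith) hroot
  refine ⟨perronVector a b c r, fun h0 => ?_, fun v => ?_, hA.ge, by rw [hA, sub_self]; simp⟩
  · exact one_ne_zero (congrFun h0 t)
  · cases v <;> simp only [perronVector, Pi.zero_apply] <;> positivity

/-- The exchange of the first two paths. -/
def swap (a b c : ℕ) : ThetaVertex a b c ≃ ThetaVertex b a c where
  toFun
    | s => s
    | t => t
    | innerA i => innerB i
    | innerB i => innerA i
    | innerC i => innerC i
  invFun
    | s => s
    | t => t
    | innerA i => innerB i
    | innerB i => innerA i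
    | innerC i => innerC i
  left_inv v := by cases v <;> rfl
  right_inv v := by cases v <;> rfl

theorem swap_nextA (i : Fin (a + 1)) : swap a b c (nextA i) = nextB i := by
  cases i using Fin.lastCases <;>
    simp [nextA_last, nextA_castSucc, nextB_last, nextB_castSucc, swap]

theorem swap_nextB (i : Fin (b + 1)) : swap a b c (nextB i) = nextA i := by
  cases i using Fin.lastCases <;>
    simp [nextA_last, nextA_castSucc, nextB_last, nextB_castSucc, swap]

theorem swap_nextC (i : Fin (c + 1)) : swap a b c (nextC i) = nextC i := by
  cases i using Fin.lastCases <;> simp [nextC_last, nextC_castSucc, swap]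

theorem isomorphic_swap (a b c : ℕ) : (thetaDigraph a b c).Isomorphic (thetaDigraph b a c) := by
  refine ⟨swap a b c, fun {v w} => ?_⟩
  have hswap {v : ThetaVertex b a c} : swap a b c w = v ↔ w = swap b a c v := by
    rw [show swap b a c v = (swap a b c).symm v by cases v <;> rfl, Equiv.eq_symm_apply]
  cases v with
  | s =>
    change (thetaDigraph b a c).Adj s _ ↔ _
    rw [adj_s_iff, adj_s_iff, hswap, hswap, swap_nextA, swap_nextB, or_comm]
  | t =>
    change (thetaDigraph b a c).Adj t _ ↔ _
    rw [adj_t_iff, adj_t_iff, hswap, swap_nextC]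
  | innerA i =>
    change (thetaDigraph b a c).Adj (innerB i) _ ↔ _
    rw [adj_innerA_iff, adj_innerB_iff, hswap, swap_nextB]
  | innerB i =>
    change (thetaDigraph b a c).Adj (innerA i) _ ↔ _
    rw [adj_innerA_iff, adj_innerB_iff, hswap, swap_nextA]
  | innerC i =>
    change (thetaDigraph b a c).Adj (innerC i) _ ↔ _
    rw [adj_innerC_iff, adj_innerC_iff, hswap, swap_nextC]

end ThetaVertex

theorem mainTheorem2 {V W : Type*} [Fintype V] [Fintype W]
    (D : Digraph V) (H : Digraph W) (hD : D.IsTheta) (hH : H.IsTheta)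
    (hcard : Fintype.card V = Fintype.card W)
    (hspec : D.complementaritySpectrum = H.complementaritySpectrum) :
    D.Isomorphic H := by
  obtain ⟨a, b, c, hab, hD⟩ := hD
  obtain ⟨a', b', c', hab', hH⟩ := hH
  have hcardD := hD.elim fun e => Fintype.card_congr e.toEquiv
  have hcardH := hH.elim fun e => Fintype.card_congr e.toEquiv
  rw [ThetaVertex.card_eq] at hcardD hcardH
  obtain ⟨r, hr, hroot⟩ := exists_one_lt_pow_eq a b c
  have hmem := (ThetaVertex.mem_complementaritySpectrum_iff_pow_eq hab hr).mpr hroot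
  rw [← hD.complementaritySpectrum_eq, hspec, hH.complementaritySpectrum_eq] at hmem
  have hroot' := (ThetaVertex.mem_complementaritySpectrum_iff_pow_eq hab' hr).mp hmem
  refine hD.trans (Digraph.Isomorphic.trans ?_ hH.symm)
  rcases theta_parameters_eq (by omega) hr hroot hroot' with ⟨rfl, rfl, rfl⟩ | ⟨rfl, rfl, rfl⟩
  · exact ⟨RelIso.refl _⟩
  · exact ThetaVertex.isomorphic_swap _ _ _
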